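/- **With anonymous oblivious transfer one can realize an authenticated broadcast channel.** Consider $n$ players whose only means of communication is *anonymous oblivious transfer* (AOT). Time is divided into synchronous rounds. In each round every player $i$ may hand to the channel, for every other player $j$, at most one bit string of a fixed length $L$. Player $j$ receives the unordered collection (multiset) of the strings sent to him in this round, where each bit of each string is independently replaced by the erasure symbol $\perp$ with probability $1/2$. So $j$ does not learn who sent which string, a sender does not learn which bits were received, and nobody else learns anything about the string. A protocol prescribes a number $R$ of rounds, the length $L$, for each player the strings to be sent (as functions of his private random coins, of what he received so far and, for the sender of the broadcast only, of the input $m$), and for each player a final output, which is either "accept $m'$" for a bit string $m'$ or "expel player $c$". An arbitrary set $A$ of players may collude: they act on their common knowledge, deviate arbitrarily from the protocol, are computationally unbounded and may use randomness of their own, and in each round they choose what they send after having seen what they receive from the honest players in that round. There is a constant $d$ such that for all $n$, every message length $\mu\ge 0$, every security parameter $k\ge 0$ and every player designated as the sender there is such a protocol, with $R,L\le (n+\mu+k+2)^d$, such that for every set $A$ of colluding players, every message $m\in\{0,1\}^\mu$ and every strategy of $A$, with probability at least $1-2^{-k}$ all of the following hold: 1. all honest players (those not in $A$) have the same output: they all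 accept the same message, or all expel the same player; 2. if the sender is honest, then every honest player accepts $m$; 3. if an honest player expels a player $c$, then $c\in A$, i.e. $c$ is a cheater. -/

import Mathlib

open scoped ENNReal

namespace AnonymousOT

/-- Bit strings of length `m`. -/
abbrev BitString (m : ℕ) : Type := Fin m → Bool

/-- What the receiver of an oblivious transfer of a string of length `m` sees: in each position
either the bit that was sent or the erasure symbol `none`. -/
abbrev Received (m : ℕ) : Type := Fin m → Option Bool

/-- Everything one player receives in one round. A multiset carries no information about who sent
which string: this is the anonymity of the channel. -/
abbrev Inbox (m : ℕ) : Type := Multiset (Received m)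

/-- Oblivious transfer of the string `b`: the bits at the positions marked in `keep` arrive, the
others are erased. -/
def erase {m : ℕ} (b : BitString m) (keep : Fin m → Bool) : Received m :=
  fun a => if keep a then some (b a) else none

/-- One round of anonymous oblivious transfer, seen by player `j`. Every player `i` in `senders`
other than `j` hands to the channel at most one string `msg i j` for `j` (`none`: no string);
`keep i j` marks the positions at which it is not erased. -/
def deliver {n m : ℕ} (senders : Finset (Fin n)) (msg : Fin n → Fin n → Option (BitString m))
    (keep : Fin n → Fin n → Fin m → Bool) (j : Fin n) : Inbox m :=
  ∑ i ∈ senders.erase j, (msg i j).elim 0 fun b => {erase b (keep i j)}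

/-- A synchronous protocol for `n` players whose only means of communication is anonymous oblivious
transfer. `X` is the type of inputs (`none`: the player has no input), `Y` the type of outputs.
A history is the list of the inboxes of the earlier rounds, the most recent one first. -/
structure AOTProtocol (n : ℕ) (X Y : Type) where
  /-- number of rounds -/
  rounds : ℕ
  /-- length of the transferred strings -/
  len : ℕ
  /-- private randomness of one player, uniformly distributed -/
  Coins : Type
  [coinsFintype : Fintype Coins]
  [coinsNonempty : Nonempty Coins]
  /-- the string that a player (first argument) sends to another one (last argument) -/
  send : Fin n → Option X → Coins → List (Inbox len) → Fin n → Option (BitString len)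
  /-- the final output of a player -/
  output : Fin n → Option X → Coins → List (Inbox len) → Y

attribute [instance] AOTProtocol.coinsFintype AOTProtocol.coinsNonempty

variable {n : ℕ} {X Y : Type}

/-- A computationally unbounded strategy of a collusion of players. The members act on their common
knowledge: random bits of their own, and for every round up to and including the current one, most
recent first, what each member received from the honest players (so the collusion is rushing).
`send r view i j` is the string sent in the name of the colluding player `i` to player `j`. -/
structure Adversary (π : AOTProtocol n X Y) where
  Tape : Type
  tape : PMF Tape
  send : Tape → List (Fin n → Inbox π.len) → Fin n → Fin n → Option (BitString π.len)

/-- The randomness of an execution: the coins of all players, and for every round, every sender and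
every receiver the positions that are not erased. -/
abbrev Randomness (π : AOTProtocol n X Y) : Type :=
  (Fin n → π.Coins) × (Fin π.rounds → Fin n → Fin n → Fin π.len → Bool)

/-- The state of an execution after some rounds. -/
structure ExecState (n m : ℕ) where
  /-- the history of each player -/
  history : Fin n → List (Inbox m)
  /-- the knowledge of the collusion -/
  view : List (Fin n → Inbox m)

/-- One round: the honest players send, the colluding players see what this delivers to them from
the honest players, then choose what they send themselves; then all strings are delivered. -/
def execStep (π : AOTProtocol n X Y) (corrupt : Finset (Fin n)) (input : Fin n → Option X)
    (adv : Adversary π) (r : adv.Tape) (coins : Fin n → π.Coins)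
    (keep : Fin n → Fin n → Fin π.len → Bool) (st : ExecState n π.len) : ExecState n π.len :=
  let honestMsg : Fin n → Fin n → Option (BitString π.len) :=
    fun i j => π.send i (input i) (coins i) (st.history i) j
  let seen : Fin n → Inbox π.len :=
    fun j => if j ∈ corrupt then deliver corruptᶜ honestMsg keep j else 0
  let view := seen :: st.view
  let msg : Fin n → Fin n → Option (BitString π.len) :=
    fun i j => if i ∈ corrupt then adv.send r view i j else honestMsg i j
  { history := fun j => deliver Finset.univ msg keep j :: st.history j
    view := view }

/-- The state after all rounds. -/
def exec (π : AOTProtocol n X Y) (corrupt : Finset (Fin n)) (input : Fin n → Option X)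
    (adv : Adversary π) (r : adv.Tape) (ω : Randomness π) : ExecState n π.len :=
  Fin.foldl π.rounds (fun st t => execStep π corrupt input adv r ω.1 (ω.2 t) st)
    { history := fun _ => [], view := [] }

/-- The outputs prescribed by the protocol. Only those of the honest players mean anything. -/
def outputs (π : AOTProtocol n X Y) (corrupt : Finset (Fin n)) (input : Fin n → Option X)
    (adv : Adversary π) (r : adv.Tape) (ω : Randomness π) : Fin n → Y :=
  fun i => π.output i (input i) (ω.1 i) ((exec π corrupt input adv r ω).history i)

/-- The joint distribution of the outputs. All coins are uniform and independent, and every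
transferred bit is erased independently with probability `1/2`. -/
noncomputable def outputLaw (π : AOTProtocol n X Y) (corrupt : Finset (Fin n))
    (input : Fin n → Option X) (adv : Adversary π) : PMF (Fin n → Y) :=
  adv.tape.bind fun r =>
    (PMF.uniformOfFintype (Randomness π)).map (outputs π corrupt input adv r)

/-- How the broadcast ends for a player: with a message, or with the expulsion of a cheater. -/
inductive Verdict (n μ : ℕ) : Type
  | accept (m : BitString μ)
  | expel (c : Fin n)

/-- The honest players' outputs are those of an authenticated broadcast of `m` by `sender`. -/
structure BroadcastOK {μ : ℕ} (corrupt : Finset (Fin n)) (sender : Fin n) (m : BitString μ)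
    (y : Fin n → Verdict n μ) : Prop where
  /-- all honest players end with the same message, or expel the same player -/
  agreement : ∀ i ∉ corrupt, ∀ j ∉ corrupt, y i = y j
  /-- if the sender is honest, then every honest player accepts her message -/
  authenticity : sender ∉ corrupt → ∀ i ∉ corrupt, y i = Verdict.accept m
  /-- only cheaters are expelled -/
  identification : ∀ i ∉ corrupt, ∀ c, y i = Verdict.expel c → c ∈ corrupt

/-- Only the sender has an input. -/
def senderInput {μ : ℕ} (sender : Fin n) (m : BitString μ) : Fin n → Option (BitString μ) :=
  fun i => if i = sender then some m else none

/-- The protocol realizes an authenticated broadcast channel with error at most `ε`: whatever set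
of players colludes, whatever its strategy and whatever the message. -/
def RealizesAuthenticatedBroadcast {μ : ℕ} (sender : Fin n)
    (π : AOTProtocol n (BitString μ) (Verdict n μ)) (ε : ℝ≥0∞) : Prop :=
  ∀ (corrupt : Finset (Fin n)) (m : BitString μ) (adv : Adversary π),
    (outputLaw π corrupt (senderInput sender m) adv).toOuterMeasure
      {y | ¬ BroadcastOK corrupt sender m y} ≤ ε

end AnonymousOT

namespace AnonymousOT

/-! ### Counting -/

/-! The protocol is Dolev–Strong agreement with signatures made of anonymously delivered keys. For
each flag, every player sends `q` a fresh random key in each of `M` rounds. The keys `q` received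
for a flag, once revealed, are his signature on it, and each verifier compares them with his own
keys. Erasures play no part in the security; repetition removes them.

Unforgeability (`ncard_forgery`): until an honest `q` raises a flag, an honest player's key for it
affects what is sent only through the outcomes of checks, so a forger has to guess `κ` bits.
Transferability (`ncard_transfer_fails`): `q` cannot tell whose key is whose, so he cannot omit the
keys of one honest verifier and keep those of another. Exchanging the two players' strings in random
rounds, a Hoeffding bound (`ncard_exchange_le`) shows that their numbers of missing keys rarely
differ by more than `Δ`. A tolerance growing by `Δ` per round then supports the Dolev–Strong
argument (`Good.raised_of_raised`).

The outcomes of checks depend on the keys and are visible to the collusion in what honest players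
forward. Both estimates therefore fix the whole table `decisions` of outcomes: executions with
indistinguishable key rounds and the same table continue alike (`Coupled.certInbox_eq`). A union
bound over all tables pays for this. -/

theorem ncard_mul_le_of_fibers {G Ω : Type*} [Fintype G] [Fintype Ω] [Nonempty G]
    (e : G × Ω ≃ G × Ω) (S : Set Ω) (b : ℕ)
    (h : ∀ ω, {g | (e (g, ω)).2 ∈ S}.ncard * b ≤ Fintype.card G) :
    S.ncard * b ≤ Fintype.card Ω := by
  classical
  have h1 : ∑ ω : Ω, {g | (e (g, ω)).2 ∈ S}.ncard = Fintype.card G * S.ncard := by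
    have : ∀ ω : Ω, {g | (e (g, ω)).2 ∈ S}.ncard = ∑ g : G, if (e (g, ω)).2 ∈ S then 1 else 0 := by
      intro ω
      rw [Set.ncard_eq_toFinset_card', Finset.sum_boole]
      simp
    simp_rw [this]
    -- As `e` is a bijection, each element of `S` is hit once for every element of `G`.
    rw [← Fintype.sum_prod_type_right (f := fun p : G × Ω => if (e p).2 ∈ S then 1 else 0),
      Equiv.sum_comp e (fun p : G × Ω => if p.2 ∈ S then 1 else 0), Fintype.sum_prod_type]
    have hS : ∑ ω : Ω, (if ω ∈ S then 1 else 0) = S.ncard := by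
      rw [Set.ncard_eq_toFinset_card', Finset.sum_boole]
      simp [Set.toFinset]
    simp [hS]
  have h2 : Fintype.card G * (S.ncard * b) ≤ Fintype.card G * Fintype.card Ω := by
    rw [← mul_assoc, ← h1, Finset.sum_mul]
    calc _ ≤ ∑ _ω : Ω, Fintype.card G := Finset.sum_le_sum fun ω _ => h ω
      _ = _ := by simp [mul_comm]
  exact Nat.le_of_mul_le_mul_left h2 Fintype.card_pos

/-- Resampling one component of a uniformly random element. -/
theorem ncard_mul_le_of_resample {G Ω : Type*} [Fintype G] [Fintype Ω] [Nonempty G]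
    (get : Ω → G) (set : G → Ω → Ω) (get_set : ∀ g ω, get (set g ω) = g)
    (set_get : ∀ ω, set (get ω) ω = ω) (set_set : ∀ g g' ω, set g (set g' ω) = set g ω)
    (S : Set Ω) (b : ℕ) (h : ∀ ω, {g | set g ω ∈ S}.ncard * b ≤ Fintype.card G) :
    S.ncard * b ≤ Fintype.card Ω := by
  have inv : Function.Involutive fun p : G × Ω => (get p.2, set p.1 p.2) := by
    rintro ⟨g, ω⟩
    simp [get_set, set_set, set_get]
  exact ncard_mul_le_of_fibers inv.toPerm S b h

theorem ncard_iUnion_mul_le {ι Ω : Type*} [Fintype ι] [Fintype Ω] (S : ι → Set Ω) {x y z : ℕ}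
    (hy : Fintype.card ι ≤ 2 ^ y) (hx : y + z ≤ x)
    (h : ∀ i, (S i).ncard * 2 ^ x ≤ Fintype.card Ω) :
    (⋃ i, S i).ncard * 2 ^ z ≤ Fintype.card Ω := by
  have h1 : (⋃ i, S i).ncard ≤ ∑ i, (S i).ncard := Set.ncard_iUnion_le_of_fintype S
  have h2 : 2 ^ y * ((⋃ i, S i).ncard * 2 ^ z) ≤ 2 ^ y * Fintype.card Ω := by
    calc 2 ^ y * ((⋃ i, S i).ncard * 2 ^ z) = (⋃ i, S i).ncard * 2 ^ (y + z) := by ring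
      _ ≤ (∑ i, (S i).ncard) * 2 ^ x := Nat.mul_le_mul h1 (Nat.pow_le_pow_right (by norm_num) hx)
      _ = ∑ i, (S i).ncard * 2 ^ x := Finset.sum_mul ..
      _ ≤ ∑ _i : ι, Fintype.card Ω := Finset.sum_le_sum fun i _ => h i
      _ = Fintype.card ι * Fintype.card Ω := by simp
      _ ≤ _ := Nat.mul_le_mul_right _ hy
  exact Nat.le_of_mul_le_mul_left h2 (by positivity)

/-- A Hoeffding bound: if `a` and `b` are exchanged at random positions, their cardinalities are
close. -/
theorem ncard_exchange_le {M Δ x : ℕ} (hx : 2 * M * x ≤ Δ ^ 2) (a b : Fin M → Prop) :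
    {g : Fin M → Bool | {r | if g r then a r else b r}.ncard + Δ <
      {r | if g r then b r else a r}.ncard}.ncard * 2 ^ x ≤ 2 ^ M := by
  classical
  rcases Nat.eq_zero_or_pos M with rfl | hM
  · have : {g : Fin 0 → Bool | {r | if g r then a r else b r}.ncard + Δ <
      {r | if g r then b r else a r}.ncard} = ∅ := by
      ext g
      simp [Set.eq_empty_of_isEmpty]
    simp [this]
  set v : Fin M → ℝ := fun r => (if b r then 1 else 0) - (if a r then 1 else 0) with hv
  set s : Bool → ℝ := fun c => if c then 1 else -1 with hs
  have hM' : (0 : ℝ) < M := by exact_mod_cast hM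
  -- This `l` minimises the Chernoff exponent `M * l ^ 2 / 2 - l * Δ`.
  set l : ℝ := Δ / M with hl
  have hl0 : 0 ≤ l := by positivity
  have hcount : ∀ g : Fin M → Bool, ({r | if g r then b r else a r}.ncard : ℝ) -
      ({r | if g r then a r else b r}.ncard : ℝ) = ∑ r, s (g r) * v r := by
    intro g
    have aux : ∀ p : Fin M → Prop, (({r | p r}.ncard : ℕ) : ℝ) = ∑ r, if p r then 1 else 0 := by
      intro p
      rw [Set.ncard_eq_toFinset_card', Finset.sum_boole]
      simp
    rw [aux, aux, ← Finset.sum_sub_distrib]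
    refine Finset.sum_congr rfl fun r _ => ?_
    cases h : g r <;> simp [hs, hv]
  have hsum : ∑ g : Fin M → Bool, Real.exp (l * ∑ r, s (g r) * v r) ≤
      2 ^ M * Real.exp (M * (l ^ 2 / 2)) := by
    have e1 : ∀ g : Fin M → Bool, Real.exp (l * ∑ r, s (g r) * v r) =
        ∏ r, Real.exp (l * (s (g r) * v r)) := by
      intro g
      rw [Finset.mul_sum, Real.exp_sum]
    simp_rw [e1]
    have e2 : ∑ g : Fin M → Bool, ∏ r, Real.exp (l * (s (g r) * v r)) =
        ∏ r : Fin M, ∑ c : Bool, Real.exp (l * (s c * v r)) := by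
      rw [Finset.prod_univ_sum, Fintype.piFinset_univ]
    rw [e2]
    calc _ ≤ ∏ _r : Fin M, 2 * Real.exp (l ^ 2 / 2) := by
          refine Finset.prod_le_prod (fun r _ => by positivity) fun r _ => ?_
          have h1 : ∑ c : Bool, Real.exp (l * (s c * v r)) = 2 * Real.cosh (l * v r) := by
            rw [Real.cosh_eq]
            simp [hs]
            ring
          rw [h1]
          have h2 : (l * v r) ^ 2 ≤ l ^ 2 := by
            by_cases ha : a r <;> by_cases hb : b r <;> simp [hv, ha, hb] <;> positivity
          have h3 := Real.cosh_le_exp_half_sq (l * v r)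
          have h4 : Real.exp ((l * v r) ^ 2 / 2) ≤ Real.exp (l ^ 2 / 2) :=
            Real.exp_le_exp.2 (by linarith)
          linarith
      _ = _ := by
          rw [Finset.prod_const, mul_pow, ← Real.exp_nat_mul]
          simp
  set B := {g : Fin M → Bool | {r | if g r then a r else b r}.ncard + Δ <
      {r | if g r then b r else a r}.ncard} with hB
  have hmarkov : (B.ncard : ℝ) * Real.exp (l * Δ) ≤
      ∑ g : Fin M → Bool, Real.exp (l * ∑ r, s (g r) * v r) := by
    rw [Set.ncard_eq_toFinset_card', ← nsmul_eq_mul, ← Finset.sum_const]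
    refine le_trans (Finset.sum_le_sum fun g hg => ?_)
      (Finset.sum_le_sum_of_subset_of_nonneg (Finset.subset_univ B.toFinset)
        fun g _ _ => (Real.exp_pos _).le)
    refine Real.exp_le_exp.2 (mul_le_mul_of_nonneg_left ?_ hl0)
    rw [← hcount]
    have : g ∈ B := by simpa using hg
    have h1 : ({r | if g r then a r else b r}.ncard : ℝ) + Δ <
      ({r | if g r then b r else a r}.ncard : ℝ) := by exact_mod_cast this
    linarith
  have hexp : (2 : ℝ) ^ x * Real.exp (M * (l ^ 2 / 2)) ≤ Real.exp (l * Δ) := by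
    have h2 : (2 : ℝ) ^ x ≤ Real.exp x := by
      have : (2 : ℝ) ≤ Real.exp 1 := by linarith [Real.add_one_le_exp (1 : ℝ)]
      calc (2 : ℝ) ^ x ≤ Real.exp 1 ^ x := pow_le_pow_left₀ (by norm_num) this x
        _ = Real.exp x := by rw [← Real.exp_nat_mul]; simp
    refine (mul_le_mul_of_nonneg_right h2 (Real.exp_pos _).le).trans ?_
    rw [← Real.exp_add]
    refine Real.exp_le_exp.2 ?_
    have hx' : (2 : ℝ) * M * x ≤ (Δ : ℝ) ^ 2 := by exact_mod_cast hx
    have e1 : (M : ℝ) * (l ^ 2 / 2) = (Δ : ℝ) ^ 2 / (2 * M) := by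
      rw [hl]; field_simp
    have e2 : l * Δ = (Δ : ℝ) ^ 2 / (2 * M) + (Δ : ℝ) ^ 2 / (2 * M) := by
      rw [hl]; field_simp; ring
    rw [e1, e2]
    gcongr
    rw [le_div_iff₀ (by positivity)]
    linarith
  have : (B.ncard : ℝ) * 2 ^ x ≤ 2 ^ M := by
    have hpos := Real.exp_pos (M * (l ^ 2 / 2))
    refine le_of_mul_le_mul_right ?_ hpos
    calc (B.ncard : ℝ) * 2 ^ x * Real.exp (M * (l ^ 2 / 2))
        = B.ncard * (2 ^ x * Real.exp (M * (l ^ 2 / 2))) := by ring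
      _ ≤ B.ncard * Real.exp (l * Δ) := by gcongr
      _ ≤ _ := hmarkov.trans hsum
  exact_mod_cast this

/-! ### Executions -/

theorem deliver_add {n m : ℕ} (A : Finset (Fin n))
    (f g : Fin n → Fin n → Option (BitString m))
    (keep : Fin n → Fin n → Fin m → Bool) (j : Fin n) :
    deliver Finset.univ (fun i j => if i ∈ A then f i j else g i j) keep j =
      deliver Aᶜ g keep j + deliver A f keep j := by
  classical
  have hd : Disjoint (Aᶜ.erase j) (A.erase j) :=
    (disjoint_compl_left (a := A)).mono (Finset.erase_subset _ _) (Finset.erase_subset _ _)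
  have hu : Finset.univ.erase j = Aᶜ.erase j ∪ A.erase j := by
    ext i
    by_cases i ∈ A <;> simp [*]
  rw [deliver, hu, Finset.sum_union hd, deliver, deliver]
  congr 1
  · refine Finset.sum_congr rfl fun i hi => ?_
    have : i ∉ A := by simpa using (Finset.mem_of_mem_erase hi)
    simp [this]
  · refine Finset.sum_congr rfl fun i hi => ?_
    simp [Finset.mem_of_mem_erase hi]

theorem card_deliver_le {n m : ℕ} (A : Finset (Fin n)) (f : Fin n → Fin n → Option (BitString m))
    (keep : Fin n → Fin n → Fin m → Bool) (j : Fin n) : (deliver A f keep j).card ≤ n := by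
  rw [deliver, Multiset.card_sum]
  calc _ ≤ ∑ _i ∈ A.erase j, 1 := by
        refine Finset.sum_le_sum fun i _ => ?_
        cases f i j <;> simp
    _ ≤ n := by
        simpa using Finset.card_le_univ (A.erase j)

theorem erase_mem_deliver {n m : ℕ} {A : Finset (Fin n)} {f : Fin n → Fin n → Option (BitString m)}
    (keep : Fin n → Fin n → Fin m → Bool) {i j : Fin n} (hi : i ∈ A) (hij : i ≠ j)
    {b : BitString m} (hb : f i j = some b) : erase b (keep i j) ∈ deliver A f keep j := by
  rw [deliver, Multiset.mem_sum]
  exact ⟨i, Finset.mem_erase.2 ⟨hij, hi⟩, by simp [hb]⟩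

/-- A set of colluding players with a strategy, the random bits of which are fixed, against a
protocol with fixed inputs. -/
structure Attack {n : ℕ} {X Y : Type} (π : AOTProtocol n X Y) where
  corrupt : Finset (Fin n)
  input : Fin n → Option X
  adv : Adversary π
  tape : adv.Tape

namespace Attack

variable {n : ℕ} {X Y : Type} {π : AOTProtocol n X Y} (a : Attack π)

/-- The positions kept in round `t`; after the last round nothing is erased. -/
def keepAt (ω : Randomness π) (t : ℕ) : Fin n → Fin n → Fin π.len → Bool :=
  if h : t < π.rounds then ω.2 ⟨t, h⟩ else fun _ _ _ => true

/-- The state of the execution after `t` rounds. -/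
def state (ω : Randomness π) : ℕ → ExecState n π.len
  | 0 => { history := fun _ => [], view := [] }
  | t + 1 => execStep π a.corrupt a.input a.adv a.tape ω.1 (keepAt ω t) (state ω t)

theorem exec_eq_state (ω : Randomness π) :
    exec π a.corrupt a.input a.adv a.tape ω = a.state ω π.rounds := by
  have key : ∀ (R : ℕ) (k : Fin R → Fin n → Fin n → Fin π.len → Bool)
      (_ : ∀ t : Fin R, keepAt ω t = k t),
      Fin.foldl R (fun st t => execStep π a.corrupt a.input a.adv a.tape ω.1 (k t) st)
        { history := fun _ => [], view := [] } = a.state ω R := by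
    intro R
    induction R with
    | zero => intro k _; simp [state]
    | succ R ih =>
      intro k hk
      rw [Fin.foldl_succ_last, ih (fun t => k t.castSucc) fun t => by simpa using hk t.castSucc,
        state]
      congr 1
      exact (hk (Fin.last R)).symm
  exact key _ _ fun t => by simp [keepAt]

/-- What the protocol prescribes to send in round `t`. -/
def honestMsg (ω : Randomness π) (t : ℕ) (i j : Fin n) : Option (BitString π.len) :=
  π.send i (a.input i) (ω.1 i) ((a.state ω t).history i) j

/-- What the honest players send to `j` in round `t`, as it is delivered. -/
def honestInbox (ω : Randomness π) (t : ℕ) (j : Fin n) : Inbox π.len :=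
  deliver a.corruptᶜ (a.honestMsg ω t) (keepAt ω t) j

/-- What `j` receives in round `t`. -/
def inbox (ω : Randomness π) (t : ℕ) (j : Fin n) : Inbox π.len :=
  a.honestInbox ω t j +
    deliver a.corrupt (a.adv.send a.tape (a.state ω (t + 1)).view) (keepAt ω t) j

theorem view_succ (ω : Randomness π) (t : ℕ) : (a.state ω (t + 1)).view =
    (fun j => if j ∈ a.corrupt then a.honestInbox ω t j else 0) :: (a.state ω t).view := rfl

theorem history_succ (ω : Randomness π) (t : ℕ) (j : Fin n) :
    (a.state ω (t + 1)).history j = a.inbox ω t j :: (a.state ω t).history j := by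
  rw [inbox, honestInbox, ← deliver_add]
  rfl

@[simp] theorem length_history (ω : Randomness π) (t : ℕ) (j : Fin n) :
    ((a.state ω t).history j).length = t := by
  induction t with
  | zero => rfl
  | succ t ih => rw [history_succ, List.length_cons, ih]

theorem getElem?_reverse_history (ω : Randomness π) {r t : ℕ} (h : r < t) (j : Fin n) :
    ((a.state ω t).history j).reverse[r]? = some (a.inbox ω r j) := by
  induction t with
  | zero => omega
  | succ t ih =>
    rw [history_succ, List.reverse_cons]
    rcases Nat.lt_succ_iff_lt_or_eq.1 h with h | rfl
    · rw [List.getElem?_append_left (by simpa using h), ih h]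
    · simp

theorem card_inbox_le (ω : Randomness π) (t : ℕ) (j : Fin n) : (a.inbox ω t j).card ≤ n := by
  rw [inbox, honestInbox, ← deliver_add]
  exact card_deliver_le ..

/-- Slots in `Fin n` keep the table of decisions finite. Since `toList` depends on the multiset
only, equal inboxes of two executions hold the same string in the same slot. -/
theorem exists_slot (ω : Randomness π) (t : ℕ) (j : Fin n) {y : Received π.len}
    (hy : y ∈ a.inbox ω t j) : ∃ s : Fin n, (a.inbox ω t j).toList[(s : ℕ)]? = some y := by
  obtain ⟨s, hs, e⟩ := List.mem_iff_getElem.1 (Multiset.mem_toList.2 hy)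
  have : s < n := hs.trans_le (by simpa using a.card_inbox_le ω t j)
  exact ⟨⟨s, this⟩, by rw [← e]; exact List.getElem?_eq_getElem hs⟩

theorem mem_inbox (ω : Randomness π) (t : ℕ) {i j : Fin n} (hi : i ∉ a.corrupt) (hij : i ≠ j)
    {b : BitString π.len} (hb : a.honestMsg ω t i j = some b) :
    erase b (keepAt ω t i j) ∈ a.inbox ω t j :=
  Multiset.mem_add.2 (.inl (erase_mem_deliver _ (by simpa using hi) hij hb))

end Attack

/-! ### The protocol

A string is a word over the positions below, every letter of which is repeated `T` times. The
sender of the broadcast raises a flag for each position and value of a bit of the message; the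
other players come to an agreement about the flags that are raised. In each of the first `M` rounds,
every player `i` sends to every other player `q` random keys, one for each flag. Player `q` raises a
flag by revealing all keys that he received for it. A certificate of this is accepted by player `i`
if it contains sufficiently many of the keys he chose. There follow `n` rounds, in which all players
forward the certificates they accepted, with a growing tolerance for missing keys. A player raises
a flag if he has enough accepted certificates, including one of the sender. -/

abbrev Flag (μ : ℕ) : Type := Fin μ × Bool

/-- Flag, owner of a certificate, key round, slot, position in the key. -/
abbrev Position (n μ M κ : ℕ) : Type := Flag μ × Fin n × Fin M × Fin n × Fin κ

def wireLen (n μ M κ T : ℕ) : ℕ := Fintype.card (Position n μ M κ × Fin T)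

noncomputable def wire (n μ M κ T : ℕ) : Position n μ M κ × Fin T ≃ Fin (wireLen n μ M κ T) :=
  Fintype.equivFin _

variable {n μ M κ T : ℕ}

/-- The repetition code. -/
noncomputable def encode (x : Position n μ M κ → Bool) : BitString (wireLen n μ M κ T) :=
  fun c => x ((wire n μ M κ T).symm c).1

noncomputable def decode (y : Received (wireLen n μ M κ T)) (p : Position n μ M κ) : Bool :=
  decide (∃ c : Fin T, y (wire n μ M κ T (p, c)) = some true)

theorem decode_erase {x : Position n μ M κ → Bool} {keep : Fin (wireLen n μ M κ T) → Bool}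
    (h : ∀ p, ∃ c, keep (wire n μ M κ T (p, c)) = true) : decode (erase (encode x) keep) = x := by
  funext p
  obtain ⟨c, hc⟩ := h p
  cases hx : x p
  · simp [decode, erase, encode, hx]
  · simpa [decode, erase, encode, hx] using ⟨c, hc⟩

/-- For each key round a list of keys. -/
abbrev Certificate (n M κ : ℕ) : Type := Fin M → Fin n → BitString κ

/-- The private randomness of one player: the keys chosen in each key round, for each receiver and
each flag. -/
abbrev Keys (n μ M κ : ℕ) : Type := Fin M → Fin n → Flag μ → BitString κ

instance : Fintype (Keys n μ M κ) := inferInstance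

/-- The certificate of `q` for the flag `f` that a received string contains. -/
noncomputable def certificate (y : Received (wireLen n μ M κ T)) (f : Flag μ) (q : Fin n) :
    Certificate n M κ :=
  fun r s b => decode y (f, q, r, s, b)

/-- The key for the flag `f` that player `i` receives in round `r`. -/
noncomputable def receivedKey (f : Flag μ) (r : Fin M) (i : Fin n)
    (y : Received (wireLen n μ M κ T)) : BitString κ :=
  -- `keyMessage` repeats the key for every owner, round and slot; which of these are read is
  -- arbitrary.
  fun b => decode y (f, i, r, i, b)

def keyMessage (K : Flag μ → BitString κ) (p : Position n μ M κ) : Bool := K p.1 p.2.2.2.2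

/-- The number of keys that do not occur in a certificate. -/
noncomputable def missing (K : Fin M → BitString κ) (c : Certificate n M κ) : ℕ :=
  -- Any slot counts, because the owner does not know who sent which key.
  {r | ∀ s, c r s ≠ K r}.ncard

/-- Slot `s` of the inbox `X` contains a certificate of `q` for `f` which `i` accepts at
level `t`. -/
def Accepts (Δ : ℕ) (i : Fin n) (K : Keys n μ M κ) (t : ℕ) (X : Inbox (wireLen n μ M κ T))
    (f : Flag μ) (q s : Fin n) : Prop :=
  q ≠ i ∧ ∃ y, X.toList[(s : ℕ)]? = some y ∧
    missing (fun r => K r q f) (certificate y f q) ≤ t * Δ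

/-- The accepted certificates and the raised flags. -/
@[ext] structure LocalState (n μ M κ : ℕ) where
  accepted : Flag μ → Fin n → Option (Certificate n M κ)
  raised : Flag μ → Prop

open Classical in
/-- The certificates accepted after reception of `X`. -/
noncomputable def nextAccepted (ok : Flag μ → Fin n → Fin n → Prop)
    (X : Inbox (wireLen n μ M κ T)) (st : LocalState n μ M κ) (f : Flag μ) (q : Fin n) :
    Option (Certificate n M κ) :=
  match st.accepted f q with
  | some c => some c
  | none => if h : ∃ s, ok f q s then
      (X.toList[(h.choose : ℕ)]?).map fun y => certificate y f q else none

/-- The keys enter only through the outcomes `ok`, so a common table of decisions suffices to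
compare executions. -/
noncomputable def nextState (sender : Fin n) (t : ℕ) (ok : Flag μ → Fin n → Fin n → Prop)
    (X : Inbox (wireLen n μ M κ T)) (st : LocalState n μ M κ) : LocalState n μ M κ where
  accepted := nextAccepted ok X st
  raised f := st.raised f ∨ (t ≤ {q | (nextAccepted ok X st f q).isSome}.ncard ∧
    (nextAccepted ok X st f sender).isSome)

/-- The state of player `i`, as a function of the history. -/
noncomputable def localState (Δ : ℕ) (sender i : Fin n) (init : Flag μ → Prop)
    (K : Keys n μ M κ) : List (Inbox (wireLen n μ M κ T)) → LocalState n μ M κ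
  | [] => { accepted := fun _ _ => none, raised := init }
  | X :: h => if h.length < M then localState Δ sender i init K h else
      -- What arrives in round `M + t` is checked at level `t + 1`.
      nextState sender (h.length - M + 1) (Accepts Δ i K (h.length - M + 1) X) X
        (localState Δ sender i init K h)

/-- The keys that player `i` received. -/
noncomputable def ownCertificate (i : Fin n) (h : List (Inbox (wireLen n μ M κ T))) (f : Flag μ) :
    Certificate n M κ :=
  -- The keys for `f` are extracted before the multiset is listed, so their order cannot depend on
  -- the keys for other flags.
  fun r s => (((h.reverse[(r : ℕ)]?).getD 0).map (receivedKey f r i)).toList[(s : ℕ)]?.getD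
    fun _ => false

open Classical in
/-- The certificate of `q` for the flag `f` that player `i` sends. -/
noncomputable def outgoing (i : Fin n) (own : Flag μ → Certificate n M κ)
    (st : LocalState n μ M κ) (f : Flag μ) (q : Fin n) : Certificate n M κ :=
  if q = i then if st.raised f then own f else fun _ _ _ => false
  else (st.accepted f q).getD fun _ _ _ => false

def certificatesMessage (c : Flag μ → Fin n → Certificate n M κ) (p : Position n μ M κ) : Bool :=
  c p.1 p.2.1 p.2.2.1 p.2.2.2.1 p.2.2.2.2

/-- The flags that a player with input `x` raises at the beginning. -/
def initialFlags (x : Option (BitString μ)) (f : Flag μ) : Prop :=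
  ∃ m ∈ x, m f.1 = f.2

open Classical in
/-- The message is accepted if the raised flags determine one. -/
noncomputable def verdict (sender : Fin n) (raised : Flag μ → Prop) : Verdict n μ :=
  if h : ∃ m : BitString μ, ∀ f, raised f ↔ m f.1 = f.2 then .accept h.choose else .expel sender

variable (M κ T) in
noncomputable abbrev flagProtocol (Δ : ℕ) (sender : Fin n) :
    AOTProtocol n (BitString μ) (Verdict n μ) where
  rounds := M + n
  len := wireLen n μ M κ T
  Coins := Keys n μ M κ
  send i x K h j :=
    if hM : h.length < M then some (encode (keyMessage (K ⟨h.length, hM⟩ j)))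
    else some (encode (certificatesMessage (outgoing i (ownCertificate i h)
      (localState Δ sender i (initialFlags x) K h))))
  output i x K h := verdict sender (localState Δ sender i (initialFlags x) K h).raised

theorem verdict_initialFlags (sender : Fin n) (m : BitString μ) :
    verdict sender (initialFlags (some m)) = .accept m := by
  have h : ∃ m' : BitString μ, ∀ f, initialFlags (some m) f ↔ m' f.1 = f.2 :=
    ⟨m, fun f => by simp [initialFlags]⟩
  rw [verdict, dif_pos h]
  congr 1
  funext x
  simpa [initialFlags] using ((h.choose_spec (x, m x)).1 (by simp [initialFlags]))

/-! ### The state of a player in the course of an execution -/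

namespace Attack

variable {Δ : ℕ} {sender : Fin n} (a : Attack (flagProtocol (μ := μ) M κ T Δ sender))
  (ω : Randomness (flagProtocol (μ := μ) M κ T Δ sender))

/-- The keys chosen by player `i`. -/
def keys (ω : Randomness (flagProtocol (μ := μ) M κ T Δ sender)) (i : Fin n) : Keys n μ M κ := ω.1 i

/-- The local state of `i` after `M + t` rounds. -/
noncomputable def stateOf (t : ℕ) (i : Fin n) : LocalState n μ M κ :=
  localState (T := T) Δ sender i (initialFlags (a.input i)) (keys ω i)
    ((a.state ω (M + t)).history i)

/-- What `i` receives in round `M + t`. -/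
noncomputable def certInbox (t : ℕ) (i : Fin n) : Inbox (wireLen n μ M κ T) := a.inbox ω (M + t) i

/-- In round `M + t`, player `i` accepts what slot `s` contains. -/
def AcceptsAt (t : ℕ) (i : Fin n) (f : Flag μ) (q s : Fin n) : Prop :=
  Accepts Δ i (keys ω i) (t + 1) (a.certInbox ω t i) f q s

theorem stateOf_zero (i : Fin n) : a.stateOf ω 0 i =
    { accepted := fun _ _ => none, raised := initialFlags (a.input i) } := by
  have : ∀ h : List (Inbox (wireLen n μ M κ T)), h.length ≤ M →
      localState Δ sender i (initialFlags (a.input i)) (keys ω i) h =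
        { accepted := fun _ _ => none, raised := initialFlags (a.input i) } := by
    intro h
    induction h with
    | nil => intro _; rfl
    | cons X h ih =>
      intro hl
      rw [List.length_cons] at hl
      rw [localState, if_pos (by omega), ih (by omega)]
  exact this _ (a.length_history ω M i).le

theorem stateOf_succ (t : ℕ) (i : Fin n) : a.stateOf ω (t + 1) i =
    nextState sender (t + 1) (a.AcceptsAt ω t i) (a.certInbox ω t i) (a.stateOf ω t i) := by
  have hl : ((a.state ω (M + t)).history i).length = M + t := a.length_history ω (M + t) i
  have hh : (a.state ω (M + (t + 1))).history i =
    a.certInbox ω t i :: (a.state ω (M + t)).history i := a.history_succ ω (M + t) i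
  rw [stateOf, hh, localState, if_neg (by omega)]
  have e : ((a.state ω (M + t)).history i).length - M + 1 = t + 1 := by omega
  rw [e]
  rfl

/-- The keys that `i` received in the key rounds, as a certificate. -/
noncomputable def ownCert (i : Fin n) (f : Flag μ) : Certificate n M κ :=
  fun r s => (((a.inbox ω r i : Inbox (wireLen n μ M κ T)).map
    (receivedKey f r i)).toList[(s : ℕ)]?).getD fun _ => false

theorem honestMsg_key {r : ℕ} (hr : r < M) (i j : Fin n) :
    a.honestMsg ω r i j = some (encode (keyMessage (keys ω i ⟨r, hr⟩ j))) := by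
  have hl := a.length_history ω r i
  have hr' : ((a.state ω r).history i).length < M := hl.trans_lt hr
  refine (dif_pos hr').trans ?_
  have : (⟨_, hr'⟩ : Fin M) = ⟨r, hr⟩ := Fin.ext hl
  rw [this]
  rfl

theorem honestMsg_certificates (t : ℕ) (i j : Fin n) :
    a.honestMsg ω (M + t) i j = some (encode (certificatesMessage
      (outgoing i (a.ownCert ω i) (a.stateOf ω t i)))) := by
  have hl := a.length_history ω (M + t) i
  have hr' : ¬ ((a.state ω (M + t)).history i).length < M := by omega
  refine (dif_neg hr').trans ?_
  have : ownCertificate (T := T) i ((a.state ω (M + t)).history i) = a.ownCert ω i := by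
    funext f r s
    have := a.getElem?_reverse_history ω (show (r : ℕ) < M + t by omega) i
    rw [ownCertificate, ownCert]
    erw [this]
    rfl
  congr 4

theorem outputs_eq (i : Fin n) :
    outputs (flagProtocol (μ := μ) M κ T Δ sender) a.corrupt a.input a.adv a.tape ω i =
      verdict sender (a.stateOf ω n i).raised := by
  rw [outputs, exec_eq_state]
  rfl

theorem raised_mono {t t' : ℕ} (h : t ≤ t') {i : Fin n} {f : Flag μ}
    (hr : (a.stateOf ω t i).raised f) : (a.stateOf ω t' i).raised f := by
  induction h with
  | refl => exact hr
  | step _ ih => rw [stateOf_succ]; exact .inl ih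

theorem accepted_succ_of_accepted {t : ℕ} {i q : Fin n} {f : Flag μ}
    (h : ((a.stateOf ω t i).accepted f q).isSome) :
    ((a.stateOf ω (t + 1) i).accepted f q).isSome := by
  rw [stateOf_succ]
  obtain ⟨c, hc⟩ := Option.isSome_iff_exists.1 h
  simp [nextState, nextAccepted, hc]

theorem accepted_succ_of_acceptsAt {t : ℕ} {i q s : Fin n} {f : Flag μ}
    (h : a.AcceptsAt ω t i f q s) : ((a.stateOf ω (t + 1) i).accepted f q).isSome := by
  cases hc : (a.stateOf ω t i).accepted f q with
  | some c => exact accepted_succ_of_accepted _ _ (by simp [hc])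
  | none =>
    have h' : ∃ s, a.AcceptsAt ω t i f q s := ⟨s, h⟩
    obtain ⟨_, y, hy, _⟩ := h'.choose_spec
    rw [stateOf_succ]
    simp only [nextState, nextAccepted, hc, dif_pos h', hy]
    rfl

theorem exists_of_accepted {t : ℕ} {i q : Fin n} {f : Flag μ} {c : Certificate n M κ}
    (h : (a.stateOf ω t i).accepted f q = some c) :
    q ≠ i ∧ ∃ t' < t, ∃ s, a.AcceptsAt ω t' i f q s ∧
      ∃ y, (a.certInbox ω t' i).toList[(s : ℕ)]? = some y ∧ c = certificate y f q ∧
        missing (fun r => keys ω i r q f) c ≤ (t' + 1) * Δ := by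
  induction t with
  | zero => simp [stateOf_zero] at h
  | succ t ih =>
    cases hc : (a.stateOf ω t i).accepted f q with
    | some c' =>
      have : c' = c := by
        rw [stateOf_succ] at h
        simpa [nextState, nextAccepted, hc] using h
      subst this
      obtain ⟨hq, t', ht, hs⟩ := ih hc
      exact ⟨hq, t', by omega, hs⟩
    | none =>
      rw [stateOf_succ] at h
      by_cases h' : ∃ s, a.AcceptsAt ω t i f q s
      · obtain ⟨hq, y, hy, hm⟩ := h'.choose_spec
        simp only [nextState, nextAccepted, hc, dif_pos h', hy, Option.map_some,
          Option.some.injEq] at h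
        subst h
        exact ⟨hq, t, by omega, _, h'.choose_spec, y, hy, rfl, hm⟩
      · simp [nextState, nextAccepted, hc, h'] at h

/-! ### Agreement -/

/-- Nothing is lost, honest players agree about certificates up to a tolerance, and no
certificate is forged. -/
structure Good : Prop where
  delivery : ∀ t < M + n, ∀ (i j : Fin n) (p : Position n μ M κ),
    ∃ c, keepAt ω t i j (wire n μ M κ T (p, c)) = true
  transfer : ∀ i ∉ a.corrupt, ∀ j ∉ a.corrupt, i ≠ j → ∀ q, q ≠ i → q ≠ j → ∀ t < n,
    ∀ (f : Flag μ) (s : Fin n) y, (a.certInbox ω t j).toList[(s : ℕ)]? = some y →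
    missing (fun r => keys ω j r q f) (certificate y f q) ≤ (t + 1) * Δ →
    missing (fun r => keys ω i r q f) (certificate y f q) ≤ (t + 2) * Δ
  unforgeable : ∀ i ∉ a.corrupt, ∀ q ∉ a.corrupt, ∀ t < n, ∀ (f : Flag μ) (s : Fin n),
    a.AcceptsAt ω t i f q s → (a.stateOf ω t q).raised f

variable {a ω}

namespace Good

theorem receivedKey_mem (hg : a.Good ω) {i j : Fin n} (hi : i ∉ a.corrupt) (hij : i ≠ j)
    (r : Fin M) (f : Flag μ) : keys ω i r j f ∈ (a.inbox ω r j).map (receivedKey f r j) := by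
  refine Multiset.mem_map.2 ⟨_, a.mem_inbox ω r hi hij (a.honestMsg_key ω r.2 i j), ?_⟩
  funext b
  rw [receivedKey, decode_erase fun p => hg.delivery r (by omega) i j p]
  rfl

theorem missing_ownCert (hg : a.Good ω) {i j : Fin n} (hi : i ∉ a.corrupt) (hij : i ≠ j)
    (f : Flag μ) : missing (fun r => keys ω i r j f) (a.ownCert ω j f) = 0 := by
  rw [missing, Set.ncard_eq_zero]
  refine Set.eq_empty_of_forall_notMem fun r hr => ?_
  obtain ⟨s, hs, e⟩ := List.mem_iff_getElem.1 (Multiset.mem_toList.2 (hg.receivedKey_mem hi hij r f))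
  have hc : (a.inbox ω r j).card ≤ n := a.card_inbox_le ω r j
  have hs' : s < n := by
    refine hs.trans_le ?_
    rw [Multiset.length_toList, Multiset.card_map]
    exact hc
  refine hr ⟨s, hs'⟩ ?_
  rw [ownCert]
  simp only
  erw [List.getElem?_eq_getElem hs]
  exact e

/-- A certificate that an honest player sends is accepted by another one if it is tolerable. -/
theorem acceptsAt_of_outgoing (hg : a.Good ω) {i j q : Fin n} (hj : j ∉ a.corrupt) (hij : j ≠ i)
    {t : ℕ} (ht : t < n) {f : Flag μ} (hq : q ≠ i)
    (hm : missing (fun r => keys ω i r q f)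
      (outgoing j (a.ownCert ω j) (a.stateOf ω t j) f q) ≤ (t + 1) * Δ) :
    ∃ s, a.AcceptsAt ω t i f q s := by
  obtain ⟨s, hs⟩ := a.exists_slot ω (M + t) i
    (a.mem_inbox ω (M + t) hj hij (a.honestMsg_certificates ω t j i))
  refine ⟨s, hq, _, hs, ?_⟩
  have : certificate (erase (encode (certificatesMessage (outgoing j (a.ownCert ω j)
      (a.stateOf ω t j)))) (keepAt ω (M + t) j i)) f q =
      outgoing j (a.ownCert ω j) (a.stateOf ω t j) f q := by
    funext r s b
    rw [certificate, decode_erase fun p => hg.delivery (M + t) (by omega) j i p]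
    rfl
  erw [this]
  exact hm

theorem exists_acceptsAt_of_raised (hg : a.Good ω) {i j : Fin n} (hi : i ∉ a.corrupt)
    (hj : j ∉ a.corrupt) (hij : j ≠ i) {t : ℕ} (ht : t < n) {f : Flag μ}
    (hr : (a.stateOf ω t j).raised f) : ∃ s, a.AcceptsAt ω t i f j s := by
  refine hg.acceptsAt_of_outgoing hj hij ht hij ?_
  rw [outgoing, if_pos rfl, if_pos hr, hg.missing_ownCert hi hij.symm]
  exact Nat.zero_le _

/-- The acceptance by `j` dates from a round `t' < t`, so the level `t' + 2` granted by `transfer`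
is at most the current `t + 1`. -/
theorem exists_acceptsAt_of_accepted (hg : a.Good ω) {i j q : Fin n} (hi : i ∉ a.corrupt)
    (hj : j ∉ a.corrupt) (hij : j ≠ i) {t : ℕ} (ht : t < n) {f : Flag μ} (hq : q ≠ i)
    (hr : ((a.stateOf ω t j).accepted f q).isSome) : ∃ s, a.AcceptsAt ω t i f q s := by
  obtain ⟨c, hc⟩ := Option.isSome_iff_exists.1 hr
  obtain ⟨hqj, t', ht', s, -, y, hy, rfl, hm⟩ := a.exists_of_accepted ω hc
  refine hg.acceptsAt_of_outgoing hj hij ht hq ?_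
  rw [outgoing, if_neg hqj, hc, Option.getD_some]
  refine (hg.transfer i hi j hj hij.symm q hq hqj t' (by omega) f s y hy hm).trans ?_
  exact Nat.mul_le_mul_right _ (by omega)

/-- The Dolev–Strong argument. Suppose `j` raises the flag on accepted certificates. If one of them
belongs to `i`, then `i` has raised it himself by unforgeability. Otherwise `i` accepts all of them
in the next round, and that of `j` besides: one more, as is then required. -/
theorem raised_of_raised (hg : a.Good ω) (hin : ∀ i ≠ sender, a.input i = none)
    {i j : Fin n} (hi : i ∉ a.corrupt) (hj : j ∉ a.corrupt) {f : Flag μ} {t : ℕ} (ht : t ≤ n)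
    (hr : (a.stateOf ω t j).raised f) : (a.stateOf ω n i).raised f := by
  by_cases hij : j = i
  · subst hij
    exact a.raised_mono ω ht hr
  induction t with
  | zero =>
    have hn : 0 < n := i.pos
    -- Initially only the sender can have raised a flag, and her certificate alone suffices at level
    -- 1.
    have hjs : j = sender := by
      by_contra hne
      rw [stateOf_zero] at hr
      simp [initialFlags, hin j hne] at hr
    obtain ⟨s, hs⟩ := hg.exists_acceptsAt_of_raised hi hj hij hn hr
    have hacc := a.accepted_succ_of_acceptsAt ω hs
    refine a.raised_mono ω (show 0 + 1 ≤ n from hn) ?_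
    have e := a.stateOf_succ ω 0 i
    rw [e] at hacc ⊢
    refine .inr ⟨?_, hjs ▸ hacc⟩
    exact (Set.ncard_pos (Set.toFinite _)).2 ⟨j, hacc⟩
  | succ t ih =>
    have e := a.stateOf_succ ω t j
    have hr' := hr
    rw [e] at hr'
    rcases hr' with h | ⟨hcard, hsend⟩
    · exact ih (by omega) h
    have hself : ∀ q, ((a.stateOf ω (t + 1) j).accepted f q).isSome → q ≠ j := by
      intro q h
      obtain ⟨c, hc⟩ := Option.isSome_iff_exists.1 h
      exact (a.exists_of_accepted ω hc).1
    have hcard' : t + 1 ≤ {q | ((a.stateOf ω (t + 1) j).accepted f q).isSome}.ncard := by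
      rw [e]; exact hcard
    have hsend' : ((a.stateOf ω (t + 1) j).accepted f sender).isSome := by
      rw [e]; exact hsend
    -- No one accepts his own certificate, so `j` holds fewer than `n` and a round remains in which
    -- to convince `i`.
    have hlt : t + 1 < n := by
      refine hcard'.trans_lt ?_
      have h1 : {q | ((a.stateOf ω (t + 1) j).accepted f q).isSome} ⊂ Set.univ :=
        Set.ssubset_univ_iff.2 fun h => hself j (by rw [Set.eq_univ_iff_forall] at h; exact h j) rfl
      simpa using Set.ncard_lt_ncard h1
    by_cases hai : ((a.stateOf ω (t + 1) j).accepted f i).isSome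
    · obtain ⟨c, hc⟩ := Option.isSome_iff_exists.1 hai
      obtain ⟨-, t', ht', s, hs, -⟩ := a.exists_of_accepted ω hc
      exact a.raised_mono ω (by omega) (hg.unforgeable j hj i hi t' (by omega) f s hs)
    have hsub : insert j {q | ((a.stateOf ω (t + 1) j).accepted f q).isSome} ⊆
        {q | ((a.stateOf ω (t + 1 + 1) i).accepted f q).isSome} := by
      rintro q (rfl | hq)
      · obtain ⟨s, hs⟩ := hg.exists_acceptsAt_of_raised hi hj hij hlt hr
        exact a.accepted_succ_of_acceptsAt ω hs
      · have hqi : q ≠ i := by rintro rfl; exact hai hq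
        obtain ⟨s, hs⟩ := hg.exists_acceptsAt_of_accepted hi hj hij hlt hqi hq
        exact a.accepted_succ_of_acceptsAt ω hs
    have hins := Set.ncard_insert_of_notMem
      (show j ∉ {q | ((a.stateOf ω (t + 1) j).accepted f q).isSome} from fun h => hself j h rfl)
    have hle := Set.ncard_le_ncard hsub
    have hs2 : ((a.stateOf ω (t + 1 + 1) i).accepted f sender).isSome := hsub (.inr hsend')
    refine a.raised_mono ω (show t + 1 + 1 ≤ n from hlt) ?_
    have hc2 : t + 1 + 1 ≤ {q | ((a.stateOf ω (t + 1 + 1) i).accepted f q).isSome}.ncard := by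
      omega
    rw [a.stateOf_succ ω (t + 1) i] at hs2 hc2 ⊢
    exact .inr ⟨hc2, hs2⟩

/-- Raising a flag later needs a certificate of the sender, which cannot be forged; she herself
never accepts one of her own. -/
theorem raised_iff_of_honest_sender (hg : a.Good ω) (hin : ∀ i ≠ sender, a.input i = none)
    (hs : sender ∉ a.corrupt) {i : Fin n} (hi : i ∉ a.corrupt) (f : Flag μ) :
    (a.stateOf ω n i).raised f ↔ initialFlags (a.input sender) f := by
  have hsender : ∀ t, (a.stateOf ω t sender).raised f ↔ initialFlags (a.input sender) f := by
    intro t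
    induction t with
    | zero => rw [stateOf_zero]
    | succ t ih =>
      rw [← ih]
      refine ⟨fun h => ?_, fun h => a.raised_mono ω t.le_succ h⟩
      have e := a.stateOf_succ ω t sender
      have h' := h
      rw [e] at h'
      rcases h' with h' | ⟨-, h'⟩
      · exact h'
      · have h2 : ((a.stateOf ω (t + 1) sender).accepted f sender).isSome := by rw [e]; exact h'
        obtain ⟨c, hc⟩ := Option.isSome_iff_exists.1 h2
        exact absurd rfl (a.exists_of_accepted ω hc).1
  constructor
  · intro h
    have hgen : ∀ t ≤ n, (a.stateOf ω t i).raised f → initialFlags (a.input sender) f := by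
      intro t
      induction t with
      | zero =>
        intro _ h
        by_cases hi' : i = sender
        · rw [stateOf_zero, hi'] at h
          exact h
        · rw [stateOf_zero] at h
          simp [initialFlags, hin i hi'] at h
      | succ t ih =>
        intro ht h
        have e := a.stateOf_succ ω t i
        have h' := h
        rw [e] at h'
        rcases h' with h' | ⟨-, h'⟩
        · exact ih (by omega) h'
        · have h2 : ((a.stateOf ω (t + 1) i).accepted f sender).isSome := by rw [e]; exact h'
          obtain ⟨c, hc⟩ := Option.isSome_iff_exists.1 h2
          obtain ⟨-, t', ht', s, hs', -⟩ := a.exists_of_accepted ω hc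
          exact (hsender t').1 (hg.unforgeable i hi sender hs t' (by omega) f s hs')
    exact hgen n le_rfl h
  · intro h
    exact hg.raised_of_raised hin hi hs (Nat.zero_le _) ((hsender 0).2 h)

theorem broadcastOK (hg : a.Good ω) {m : BitString μ} (hin : a.input = senderInput sender m) :
    BroadcastOK a.corrupt sender m
      (outputs (flagProtocol (μ := μ) M κ T Δ sender) a.corrupt a.input a.adv a.tape ω) := by
  have hin' : ∀ i ≠ sender, a.input i = none := fun i hi => by simp [hin, senderInput, hi]
  have auth : sender ∉ a.corrupt → ∀ i ∉ a.corrupt,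
      outputs (flagProtocol (μ := μ) M κ T Δ sender) a.corrupt a.input a.adv a.tape ω i =
        .accept m := by
    intro hs i hi
    rw [outputs_eq, ← verdict_initialFlags sender m]
    congr 1
    funext f
    rw [eq_iff_iff, hg.raised_iff_of_honest_sender hin' hs hi f]
    simp [hin, senderInput]
  refine ⟨fun i hi j hj => ?_, auth, fun i hi c hc => ?_⟩
  · rw [outputs_eq, outputs_eq]
    congr 1
    funext f
    rw [eq_iff_iff]
    exact ⟨hg.raised_of_raised hin' hj hi le_rfl, hg.raised_of_raised hin' hi hj le_rfl⟩
  · by_contra hcc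
    -- `verdict` expels nobody but the sender, and the message of an honest sender is accepted.
    have hcs : c = sender := by
      rw [outputs_eq, verdict] at hc
      split_ifs at hc
      exact (Verdict.expel.inj hc).symm
    rw [auth (hcs ▸ hcc) i hi] at hc
    cases hc

end Good

end Attack

/-! ### Executions that the collusion cannot distinguish -/

/-- Anonymity: permuting the senders together with their strings and erasures does not change the
inbox. -/
theorem deliver_congr_perm {m : ℕ} {A : Finset (Fin n)}
    {f f' : Fin n → Fin n → Option (BitString m)} {keep keep' : Fin n → Fin n → Fin m → Bool}
    {j : Fin n} (σ : Equiv.Perm (Fin n)) (hσ : ∀ i, i ∈ A.erase j ↔ σ i ∈ A.erase j)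
    (h : ∀ i ∈ A, i ≠ j → f' i j = f (σ i) j ∧ keep' i j = keep (σ i) j) :
    deliver A f' keep' j = deliver A f keep j := by
  refine Finset.sum_equiv σ hσ fun i hi => ?_
  obtain ⟨h1, h2⟩ := h i (Finset.mem_of_mem_erase hi) (Finset.ne_of_mem_erase hi)
  rw [h1, h2]

theorem deliver_congr {m : ℕ} {A : Finset (Fin n)}
    {f f' : Fin n → Fin n → Option (BitString m)} {keep keep' : Fin n → Fin n → Fin m → Bool}
    {j : Fin n} (h : ∀ i ∈ A, i ≠ j → f' i j = f i j ∧ keep' i j = keep i j) :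
    deliver A f' keep' j = deliver A f keep j :=
  deliver_congr_perm 1 (fun _ => Iff.rfl) h

theorem map_deliver_congr {m : ℕ} {β : Type*} {A : Finset (Fin n)} (g : Received m → β)
    {f f' : Fin n → Fin n → Option (BitString m)} {keep keep' : Fin n → Fin n → Fin m → Bool}
    {j : Fin n} (h : ∀ i ∈ A, (f' i j).map (fun b => g (erase b (keep' i j))) =
      (f i j).map fun b => g (erase b (keep i j))) :
    (deliver A f' keep' j).map g = (deliver A f keep j).map g := by
  have e : ∀ (f : Fin n → Fin n → Option (BitString m)) (keep : Fin n → Fin n → Fin m → Bool),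
      (deliver A f keep j).map g = ∑ i ∈ A.erase j,
        (((f i j).map fun b => g (erase b (keep i j))).elim 0 fun y => ({y} : Multiset β)) := by
    intro f keep
    rw [deliver, ← Multiset.coe_mapAddMonoidHom, map_sum]
    refine Finset.sum_congr rfl fun i _ => ?_
    cases f i j <;> simp
  rw [e, e]
  exact Finset.sum_congr rfl fun i hi => by rw [h i (Finset.mem_of_mem_erase hi)]

theorem decode_erase_congr {x x' : Position n μ M κ → Bool} {p : Position n μ M κ}
    (h : x p = x' p) (keep : Fin (wireLen n μ M κ T) → Bool) :
    decode (erase (encode x) keep) p = decode (erase (encode x') keep) p := by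
  simp [decode, erase, encode, h]

namespace Attack

variable {Δ : ℕ} {sender : Fin n} (a : Attack (flagProtocol (μ := μ) M κ T Δ sender))

/-- All decisions about certificates. -/
def decisions (ω : Randomness (flagProtocol (μ := μ) M κ T Δ sender)) :
    Fin n × Fin n × Flag μ × Fin n × Fin n → Prop :=
  fun d => a.AcceptsAt ω d.1 d.2.1 d.2.2.1 d.2.2.2.1 d.2.2.2.2

/-- The key rounds of two executions look alike, apart from the keys received by `q` for the
flag `f` where `Hidden f q`, and the same decisions are made. -/
structure Coupled (ω ω' : Randomness (flagProtocol (μ := μ) M κ T Δ sender))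
    (Hidden : Flag μ → Fin n → Prop) : Prop where
  corruptInbox : ∀ t < M, ∀ j ∈ a.corrupt, a.honestInbox ω t j = a.honestInbox ω' t j
  receivedKeys : ∀ r : Fin M, ∀ j ∉ a.corrupt, ∀ f, ¬ Hidden f j →
    (a.honestInbox ω r j).map (receivedKey f r j) = (a.honestInbox ω' r j).map (receivedKey f r j)
  keep_corrupt : ∀ t < M, ∀ i ∈ a.corrupt, keepAt ω t i = keepAt ω' t i
  keep_late : ∀ t, M ≤ t → keepAt ω t = keepAt ω' t
  decisions : a.decisions ω = a.decisions ω'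

namespace Coupled

variable {a} {ω ω' : Randomness (flagProtocol (μ := μ) M κ T Δ sender)}
  {Hidden : Flag μ → Fin n → Prop} (h : a.Coupled ω ω' Hidden)

include h

theorem view_eq {t : ℕ} (ht : t ≤ M) : (a.state ω t).view = (a.state ω' t).view := by
  induction t with
  | zero => rfl
  | succ t ih =>
    rw [view_succ, view_succ, ih (by omega)]
    congr 1
    funext j
    split_ifs with hj
    · exact h.corruptInbox t ht j hj
    · rfl

theorem ownCert_eq {i : Fin n} (hi : i ∉ a.corrupt) {f : Flag μ} (hf : ¬ Hidden f i) :
    a.ownCert ω i f = a.ownCert ω' i f := by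
  funext r s
  have : (a.inbox ω r i).map (receivedKey f r i) = (a.inbox ω' r i).map (receivedKey f r i) := by
    rw [inbox, inbox, Multiset.map_add, Multiset.map_add, h.receivedKeys r i hi f hf,
      h.view_eq (show (r : ℕ) + 1 ≤ M from r.2)]
    congr 2
    exact deliver_congr fun i hi _ => ⟨rfl, by rw [h.keep_corrupt r r.2 i hi]⟩
  rw [ownCert, ownCert, this]

/-- Honest players' own certificates differ at most for hidden flags they have not raised, and those
are not sent. Hence the honest strings agree, then the view of the collusion, then its replies. -/
theorem certInbox_eq_of_state_eq {t : ℕ}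
    (hv : (a.state ω (M + t)).view = (a.state ω' (M + t)).view)
    (hs : ∀ i ∉ a.corrupt, a.stateOf ω t i = a.stateOf ω' t i)
    (hh : ∀ f, ∀ q ∉ a.corrupt, Hidden f q → ¬ (a.stateOf ω t q).raised f) :
    (a.state ω (M + (t + 1))).view = (a.state ω' (M + (t + 1))).view ∧
      ∀ j, a.certInbox ω t j = a.certInbox ω' t j := by
  have hk := h.keep_late (M + t) (by omega)
  have hm : ∀ j, a.honestInbox ω (M + t) j = a.honestInbox ω' (M + t) j := by
    intro j
    refine deliver_congr fun i hi _ => ⟨?_, by rw [hk]⟩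
    rw [Finset.mem_compl] at hi
    rw [honestMsg_certificates, honestMsg_certificates, hs i hi]
    have : outgoing i (a.ownCert ω i) (a.stateOf ω' t i) =
        outgoing i (a.ownCert ω' i) (a.stateOf ω' t i) := by
      funext f q
      rw [outgoing, outgoing]
      split_ifs with h1 h2
      · exact h.ownCert_eq hi fun hf => hh f i hi hf (hs i hi ▸ h2)
      · rfl
      · rfl
    rw [this]
  have hv' : (a.state ω (M + (t + 1))).view = (a.state ω' (M + (t + 1))).view := by
    rw [← add_assoc, view_succ, view_succ, hv]
    simp_rw [hm]
  refine ⟨hv', fun j => ?_⟩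
  rw [certInbox, certInbox, inbox, inbox, hm j, hk]
  rw [← add_assoc] at hv'
  rw [hv']

/-- Induction on the rounds: equal inboxes and the common decisions give equal states, even though
the keys behind the decisions differ. -/
theorem certInbox_eq {t : ℕ} (ht : t ≤ n)
    (hh : ∀ f, ∀ q ∉ a.corrupt, Hidden f q → ¬ (a.stateOf ω t q).raised f) (j : Fin n) :
    a.certInbox ω t j = a.certInbox ω' t j := by
  have key : ∀ u ≤ t, (a.state ω (M + u)).view = (a.state ω' (M + u)).view ∧
      ∀ i ∉ a.corrupt, a.stateOf ω u i = a.stateOf ω' u i := by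
    intro u
    induction u with
    | zero =>
      intro _
      exact ⟨h.view_eq le_rfl, fun i _ => by rw [stateOf_zero, stateOf_zero]⟩
    | succ u ih =>
      intro hu
      obtain ⟨hv, hs⟩ := ih (by omega)
      obtain ⟨hv', hX⟩ := h.certInbox_eq_of_state_eq hv hs fun f q hq hf hr =>
        hh f q hq hf (a.raised_mono ω (by omega) hr)
      refine ⟨hv', fun i hi => ?_⟩
      rw [stateOf_succ, stateOf_succ, hX i, hs i hi]
      congr 1
      funext f q s
      exact congrFun h.decisions (⟨u, by omega⟩, i, f, q, s)
  obtain ⟨hv, hs⟩ := key t le_rfl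
  exact (h.certInbox_eq_of_state_eq hv hs hh).2 j

end Coupled

/-! ### Exchanging the keys of two players -/

def exchange (i j : Fin n) (c : Bool) : Equiv.Perm (Fin n) := if c then Equiv.swap i j else 1

theorem exchange_xor (i j : Fin n) (c c' : Bool) (k : Fin n) :
    exchange i j c' (exchange i j c k) = exchange i j (c ^^ c') k := by
  cases c <;> cases c' <;> simp [exchange]

/-- In the key rounds `r` with `g r`, the players `i` and `j` exchange the strings sent to `q`. -/
def exchangeKeys (i j q : Fin n) (g : Fin M → Bool)
    (ω : Randomness (flagProtocol (μ := μ) M κ T Δ sender)) :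
    Randomness (flagProtocol (μ := μ) M κ T Δ sender) :=
  (fun i' r q' => if q' = q then ω.1 (exchange i j (g r) i') r q' else ω.1 i' r q',
    fun t i' q' => if h : (t : ℕ) < M ∧ q' = q then ω.2 t (exchange i j (g ⟨t, h.1⟩) i') q'
      else ω.2 t i' q')

theorem exchangeKeys_exchangeKeys (i j q : Fin n) (g g' : Fin M → Bool)
    (ω : Randomness (flagProtocol (μ := μ) M κ T Δ sender)) :
    exchangeKeys i j q g (exchangeKeys i j q g' ω) =
      exchangeKeys i j q (fun r => g r ^^ g' r) ω := by
  refine Prod.ext ?_ ?_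
  · funext i' r q'
    by_cases hq : q' = q <;> simp [exchangeKeys, hq, exchange_xor]
  · funext t i' q'
    by_cases hq : (t : ℕ) < M ∧ q' = q <;> simp [exchangeKeys, hq, exchange_xor]

theorem exchangeKeys_false (i j q : Fin n)
    (ω : Randomness (flagProtocol (μ := μ) M κ T Δ sender)) :
    exchangeKeys i j q (fun _ => false) ω = ω := by
  refine Prod.ext ?_ ?_ <;> funext <;> simp [exchangeKeys, exchange]

theorem keepAt_exchangeKeys {i j q : Fin n} (g : Fin M → Bool)
    (ω : Randomness (flagProtocol (μ := μ) M κ T Δ sender)) (r : Fin M) (i' q' : Fin n) :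
    keepAt (exchangeKeys i j q g ω) r i' q' =
      keepAt ω r (if q' = q then exchange i j (g r) i' else i') q' := by
  have : (r : ℕ) < M + n := by omega
  rw [keepAt, keepAt, dif_pos this, dif_pos this]
  by_cases hq : q' = q <;> simp [exchangeKeys, hq]

-- The keys for all flags move together with the erasures, so the exchange merely permutes honest
-- senders in the inbox of `q`. Only checks could reveal it, and `hd` excludes that.
variable {a} in
theorem coupled_exchangeKeys {i j q : Fin n} (hi : i ∉ a.corrupt) (hj : j ∉ a.corrupt)
    (hqi : q ≠ i) (hqj : q ≠ j) (g : Fin M → Bool)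
    {ω : Randomness (flagProtocol (μ := μ) M κ T Δ sender)}
    (hd : a.decisions (exchangeKeys i j q g ω) = a.decisions ω) :
    a.Coupled (exchangeKeys i j q g ω) ω fun _ _ => False := by
  have hX : ∀ (r : Fin M) k, a.honestInbox (exchangeKeys i j q g ω) r k = a.honestInbox ω r k := by
    intro r k
    refine deliver_congr_perm (if k = q then exchange i j (g r) else 1) (fun l => ?_)
      fun l _ _ => ⟨?_, ?_⟩
    · by_cases hk : k = q
      · subst hk
        cases g r
        · simp [exchange]
        · simp only [exchange, if_true]
          by_cases h1 : l = i
          · subst h1; simp [hi, hj, hqi.symm, hqj.symm]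
          · by_cases h2 : l = j
            · subst h2; simp [hi, hj, hqi.symm, hqj.symm]
            · rw [Equiv.swap_apply_of_ne_of_ne h1 h2]
      · simp [hk]
    · rw [honestMsg_key a _ r.2, honestMsg_key a _ r.2]
      by_cases hk : k = q <;> simp [keys, exchangeKeys, hk]
    · rw [keepAt_exchangeKeys]
      by_cases hk : k = q <;> simp [hk]
  refine ⟨fun t ht k _ => hX ⟨t, ht⟩ k, fun r k _ f _ => by rw [hX], fun t ht k hk => ?_,
    fun t ht => ?_, hd⟩
  · funext q'
    rw [keepAt_exchangeKeys g ω ⟨t, ht⟩]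
    have h1 : k ≠ i := fun h => hi (h ▸ hk)
    have h2 : k ≠ j := fun h => hj (h ▸ hk)
    cases hg : g ⟨t, ht⟩ <;> simp [exchange, Equiv.swap_apply_of_ne_of_ne h1 h2]
  · rw [keepAt, keepAt]
    split_ifs with h
    · funext i' q'
      simp [exchangeKeys, ht.not_gt]
    · rfl

/-- Randomize over the exchange `g`. All bad `g` lead to the same decisions, hence to the same
received string. Its missing keys are thus fixed sets, assigned to `i` and `j` according to `g`, and
the Hoeffding bound applies. -/
theorem ncard_transfer_fails {x : ℕ} (hx : 2 * M * x ≤ Δ ^ 2) {i j q : Fin n}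
    (hi : i ∉ a.corrupt) (hj : j ∉ a.corrupt) (hqi : q ≠ i) (hqj : q ≠ j)
    (t : Fin n) (f : Flag μ) (s : Fin n) (d : Fin n × Fin n × Flag μ × Fin n × Fin n → Prop) :
    {ω : Randomness (flagProtocol (μ := μ) M κ T Δ sender) | a.decisions ω = d ∧
      ∃ y, (a.certInbox ω t j).toList[(s : ℕ)]? = some y ∧
        missing (fun r => keys ω j r q f) (certificate y f q) ≤ (t + 1) * Δ ∧
        (t + 2) * Δ < missing (fun r => keys ω i r q f) (certificate y f q)}.ncard * 2 ^ x ≤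
      Fintype.card (Randomness (flagProtocol (μ := μ) M κ T Δ sender)) := by
  have inv : Function.Involutive fun p : (Fin M → Bool) ×
      Randomness (flagProtocol (μ := μ) M κ T Δ sender) => (p.1, exchangeKeys i j q p.1 p.2) := by
    rintro ⟨g, ω⟩
    simp [exchangeKeys_exchangeKeys, exchangeKeys_false]
  refine ncard_mul_le_of_fibers (inv.toPerm _) _ _ fun ω => ?_
  rw [show Fintype.card (Fin M → Bool) = 2 ^ M by simp]
  set B := {g | (inv.toPerm _ (g, ω)).2 ∈ {ω | a.decisions ω = d ∧
      ∃ y, (a.certInbox ω t j).toList[(s : ℕ)]? = some y ∧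
        missing (fun r => keys ω j r q f) (certificate y f q) ≤ (t + 1) * Δ ∧
        (t + 2) * Δ < missing (fun r => keys ω i r q f) (certificate y f q)}} with hB
  -- One bad `g₀` serves as reference and supplies the string `y`.
  rcases B.eq_empty_or_nonempty with h0 | ⟨g₀, hd₀, y, hy, -⟩
  · simp [h0]
  refine le_trans (Nat.mul_le_mul_right _ (Set.ncard_le_ncard ?_)) (ncard_exchange_le hx
    (fun r => ∀ l, certificate y f q r l ≠ keys ω i r q f)
    (fun r => ∀ l, certificate y f q r l ≠ keys ω j r q f))
  rintro g ⟨hd, y', hy', hmj, hmi⟩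
  have e : exchangeKeys i j q g ω =
      exchangeKeys i j q (fun r => g r ^^ g₀ r) (exchangeKeys i j q g₀ ω) := by
    rw [exchangeKeys_exchangeKeys]
    simp
  have hc := coupled_exchangeKeys (a := a) hi hj hqi hqj (fun r => g r ^^ g₀ r)
    (ω := exchangeKeys i j q g₀ ω) (by rw [← e]; exact hd.trans hd₀.symm)
  have hX := hc.certInbox_eq (t := t) t.2.le (fun _ _ _ h => h.elim) j
  rw [← e] at hX
  have hyy : y' = y := by
    have h1 : (a.certInbox (exchangeKeys i j q g ω) t j).toList[(s : ℕ)]? = some y' := hy'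
    rw [hX] at h1
    exact Option.some.inj (h1.symm.trans hy)
  subst hyy
  have hkj : missing (fun r => keys (exchangeKeys i j q g ω) j r q f) (certificate y' f q) =
      {r | if g r then ∀ l, certificate y' f q r l ≠ keys ω i r q f else
        ∀ l, certificate y' f q r l ≠ keys ω j r q f}.ncard := by
    rw [missing]
    congr 1
    ext r
    cases hg : g r <;> simp [keys, exchangeKeys, exchange, hg]
  have hki : missing (fun r => keys (exchangeKeys i j q g ω) i r q f) (certificate y' f q) =
      {r | if g r then ∀ l, certificate y' f q r l ≠ keys ω j r q f else
        ∀ l, certificate y' f q r l ≠ keys ω i r q f}.ncard := by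
    rw [missing]
    congr 1
    ext r
    cases hg : g r <;> simp [keys, exchangeKeys, exchange, hg]
  have hmj' : missing (fun r => keys (exchangeKeys i j q g ω) j r q f) (certificate y' f q) ≤
    (t + 1) * Δ := hmj
  have hmi' : (t + 2) * Δ <
    missing (fun r => keys (exchangeKeys i j q g ω) i r q f) (certificate y' f q) := hmi
  rw [Set.mem_ofPred_eq, ← hkj, ← hki]
  nlinarith

/-! ### Replacing a key -/

/-- Player `i` chooses the key `k` for `q` and the flag `f` in round `r`. -/
def setKey (i q : Fin n) (f : Flag μ) (r : Fin M) (k : BitString κ)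
    (ω : Randomness (flagProtocol (μ := μ) M κ T Δ sender)) :
    Randomness (flagProtocol (μ := μ) M κ T Δ sender) :=
  (fun i' r' q' f' => if i' = i ∧ r' = r ∧ q' = q ∧ f' = f then k else ω.1 i' r' q' f', ω.2)

-- The new key can show only in the inbox of the honest `q`, at positions belonging to `f`.
variable {a} in
theorem coupled_setKey {i q : Fin n} (hq : q ∉ a.corrupt) (f : Flag μ) (r : Fin M)
    (k : BitString κ) {ω : Randomness (flagProtocol (μ := μ) M κ T Δ sender)}
    (hd : a.decisions ω = a.decisions (setKey i q f r k ω)) :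
    a.Coupled ω (setKey i q f r k ω) fun f' q' => f' = f ∧ q' = q := by
  have hk : ∀ t, keepAt (setKey i q f r k ω) t = keepAt ω t := fun _ => rfl
  refine ⟨fun t ht j hj => ?_, fun r' j _ f' hf => ?_, fun t _ i _ => by rw [hk],
    fun t _ => by rw [hk], hd⟩
  · refine deliver_congr fun i' _ _ => ⟨?_, rfl⟩
    have hjq : j ≠ q := fun h => hq (h ▸ hj)
    rw [honestMsg_key a _ ht, honestMsg_key a _ ht]
    simp [keys, setKey, hjq]
  · refine map_deliver_congr _ fun i' _ => ?_
    rw [honestMsg_key a _ r'.2, honestMsg_key a _ r'.2, hk, Option.map_some, Option.map_some]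
    congr 1
    funext b
    refine decode_erase_congr ?_ _
    have : ¬ (j = q ∧ f' = f) := fun h => hf h.symm
    simp [keyMessage, keys, setKey, this]

/-- With all else fixed, two bad values of the key would give coupled executions with the same
certificate, whose slot `l` in round `r` would equal both. So at most one of `2 ^ κ` values is bad.
-/
theorem ncard_forgery {i q : Fin n} (hq : q ∉ a.corrupt) (t : Fin n) (f : Flag μ) (s : Fin n)
    (r : Fin M) (l : Fin n) (d : Fin n × Fin n × Flag μ × Fin n × Fin n → Prop) :
    {ω : Randomness (flagProtocol (μ := μ) M κ T Δ sender) | a.decisions ω = d ∧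
      ¬ (a.stateOf ω t q).raised f ∧ ∃ y, (a.certInbox ω t i).toList[(s : ℕ)]? = some y ∧
        certificate y f q r l = keys ω i r q f}.ncard * 2 ^ κ ≤
      Fintype.card (Randomness (flagProtocol (μ := μ) M κ T Δ sender)) := by
  refine ncard_mul_le_of_resample (G := BitString κ) (fun ω => keys ω i r q f)
    (setKey i q f r) (fun g ω => by simp [keys, setKey]) (fun ω => ?_) (fun g g' ω => ?_) _ _
    fun ω => ?_
  · refine Prod.ext ?_ rfl
    funext i' r' q' f'
    simp only [setKey, keys]
    split_ifs with h
    · obtain ⟨rfl, rfl, rfl, rfl⟩ := h; rfl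
    · rfl
  · refine Prod.ext ?_ rfl
    funext i' r' q' f'
    simp only [setKey]
    split_ifs <;> rfl
  · rw [show Fintype.card (BitString κ) = 2 ^ κ by simp]
    refine (Nat.mul_le_mul_right _ ?_).trans (one_mul _).le
    refine (Set.ncard_le_one_iff (Set.toFinite _)).2 ?_
    rintro g g' ⟨hd, hr, y, hy, hg⟩ ⟨hd', -, y', hy', hg'⟩
    have e : setKey i q f r g' ω = setKey i q f r g' (setKey i q f r g ω) := by
      refine Prod.ext ?_ rfl
      funext i' r' q' f'
      simp only [setKey]
      split_ifs <;> rfl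
    have hc := coupled_setKey (a := a) (i := i) hq f r g' (ω := setKey i q f r g ω)
      (by rw [← e]; exact hd.trans hd'.symm)
    have hX := hc.certInbox_eq (t := t) t.2.le (fun f' q' _ h => by rw [h.1, h.2]; exact hr) i
    rw [← e] at hX
    rw [hX] at hy
    have hyy : y = y' := Option.some.inj (hy.symm.trans hy')
    subst hyy
    have h1 : keys (setKey i q f r g ω) i r q f = g := by simp [keys, setKey]
    have h2 : keys (setKey i q f r g' ω) i r q f = g' := by simp [keys, setKey]
    rw [← h1, ← h2, ← hg, ← hg']

/-! ### Loss of a letter -/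

theorem ncard_loss (t : Fin (M + n)) (i j : Fin n) (p : Position n μ M κ) :
    {ω : Randomness (flagProtocol (μ := μ) M κ T Δ sender) |
      ∀ c, ω.2 t i j (wire n μ M κ T (p, c)) = false}.ncard * 2 ^ T ≤
      Fintype.card (Randomness (flagProtocol (μ := μ) M κ T Δ sender)) := by
  refine ncard_mul_le_of_resample (G := Fin T → Bool)
    (fun (ω : Randomness (flagProtocol (μ := μ) M κ T Δ sender)) c => ω.2 t i j (wire n μ M κ T (p, c)))
    (fun g ω => (ω.1, fun t' i' j' c => if t' = t ∧ i' = i ∧ j' = j ∧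
      ((wire n μ M κ T).symm c).1 = p then g ((wire n μ M κ T).symm c).2 else ω.2 t' i' j' c))
    (fun g ω => by simp) (fun ω => ?_) (fun g g' ω => ?_) _ _ fun ω => ?_
  · refine Prod.ext rfl ?_
    funext t' i' j' c
    simp only
    split_ifs with h
    · obtain ⟨rfl, rfl, rfl, rfl⟩ := h
      simp
    · rfl
  · refine Prod.ext rfl ?_
    funext t' i' j' c
    simp only
    split_ifs <;> rfl
  · rw [show Fintype.card (Fin T → Bool) = 2 ^ T by simp]
    refine (Nat.mul_le_mul_right _ ?_).trans (one_mul _).le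
    refine (Set.ncard_le_one_iff (Set.toFinite _)).2 fun {g g'} hg hg' => ?_
    funext c
    have h1 := hg c
    have h2 := hg' c
    simp only [Equiv.symm_apply_apply, and_self, if_true] at h1 h2
    rw [h1, h2]

end Attack

/-! ### The probability of a failure -/

namespace Attack

variable {Δ : ℕ} {sender : Fin n} (a : Attack (flagProtocol (μ := μ) M κ T Δ sender))

abbrev Decisions (n μ : ℕ) : Type := Fin n × Fin n × Flag μ × Fin n × Fin n → Prop

/-- A letter is lost. -/
def lossEvent (e : Fin (M + n) × Fin n × Fin n × Position n μ M κ) :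
    Set (Randomness (flagProtocol (μ := μ) M κ T Δ sender)) :=
  {ω | ∀ c, ω.2 e.1 e.2.1 e.2.2.1 (wire n μ M κ T (e.2.2.2, c)) = false}

/-- A certificate is accepted by an honest player, but cannot be transferred to another one. -/
def transferEvent (e : (Fin n × Fin n × Fin n × Fin n × Flag μ × Fin n) × Decisions n μ) :
    Set (Randomness (flagProtocol (μ := μ) M κ T Δ sender)) :=
  let ((i, j, q, t, f, s), d) := e
  {ω | (i ∉ a.corrupt ∧ j ∉ a.corrupt ∧ i ≠ j ∧ q ≠ i ∧ q ≠ j) ∧ a.decisions ω = d ∧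
    ∃ y, (a.certInbox ω t j).toList[(s : ℕ)]? = some y ∧
      missing (fun r => keys ω j r q f) (certificate y f q) ≤ (t + 1) * Δ ∧
      (t + 2) * Δ < missing (fun r => keys ω i r q f) (certificate y f q)}

/-- A key of an honest player occurs in a certificate of a player who did not raise the flag. -/
def forgeryEvent
    (e : (Fin n × Fin n × Fin n × Flag μ × Fin n × Fin M × Fin n) × Decisions n μ) :
    Set (Randomness (flagProtocol (μ := μ) M κ T Δ sender)) :=
  let ((i, q, t, f, s, r, l), d) := e
  {ω | q ∉ a.corrupt ∧ a.decisions ω = d ∧ ¬ (a.stateOf ω t q).raised f ∧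
    ∃ y, (a.certInbox ω t i).toList[(s : ℕ)]? = some y ∧
      certificate y f q r l = keys ω i r q f}

theorem not_good_subset (hM : n * Δ < M) : {ω | ¬ a.Good ω} ⊆
    (⋃ e, lossEvent e) ∪ (⋃ e, a.transferEvent e) ∪ ⋃ e, a.forgeryEvent e := by
  intro ω hω
  by_contra hn
  simp only [Set.mem_union, Set.mem_iUnion, not_or, not_exists] at hn
  obtain ⟨⟨h1, h2⟩, h3⟩ := hn
  refine hω ⟨fun t ht i j p => ?_, fun i hi j hj hij q hqi hqj t ht f s y hy hm => ?_,
    fun i hi q hq t ht f s hs => ?_⟩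
  · by_contra hc
    refine h1 (⟨t, ht⟩, i, j, p) fun c => ?_
    have : ¬ keepAt ω t i j (wire n μ M κ T (p, c)) = true := fun h => hc ⟨c, h⟩
    rw [keepAt, dif_pos ht] at this
    simpa using this
  · by_contra hc
    exact h2 ((i, j, q, ⟨t, ht⟩, f, s), a.decisions ω)
      ⟨⟨hi, hj, hij, hqi, hqj⟩, rfl, y, hy, hm, not_le.1 hc⟩
  · by_contra hr
    obtain ⟨-, y, hy, hm⟩ := hs
    -- The tolerance stays below `M`, so an accepted certificate contains at least one of the
    -- verifier's keys.
    have hlt : missing (fun r => keys ω i r q f) (certificate y f q) < M := by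
      refine (hm.trans ?_).trans_lt hM
      exact Nat.mul_le_mul_right _ ht
    obtain ⟨r, hr'⟩ : ∃ r, ¬ ∀ l, certificate y f q r l ≠ keys ω i r q f := by
      by_contra hall
      push Not at hall
      have : {r | ∀ l, certificate y f q r l ≠ keys ω i r q f} = Set.univ :=
        Set.eq_univ_of_forall hall
      rw [missing, this] at hlt
      simp at hlt
    push Not at hr'
    obtain ⟨l, hl⟩ := hr'
    exact h3 ((i, q, ⟨t, ht⟩, f, s, r, l), a.decisions ω) ⟨hq, rfl, hr, y, hy, hl⟩

/-- Three families of at most `2 ^ y` events, each of probability at most `2 ^ -(y + k + 2)`, leave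
a failure probability of at most `3 / 4 * 2 ^ -k`. -/
theorem ncard_not_good {x y k : ℕ} (hM : n * Δ < M) (hx : 2 * M * x ≤ Δ ^ 2)
    (hT : y + (k + 2) ≤ T) (hκ : y + (k + 2) ≤ κ) (hy : y + (k + 2) ≤ x)
    (h1 : Fintype.card (Fin (M + n) × Fin n × Fin n × Position n μ M κ) ≤ 2 ^ y)
    (h2 : Fintype.card ((Fin n × Fin n × Fin n × Fin n × Flag μ × Fin n) × Decisions n μ) ≤ 2 ^ y)
    (h3 : Fintype.card ((Fin n × Fin n × Fin n × Flag μ × Fin n × Fin M × Fin n) ×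
      Decisions n μ) ≤ 2 ^ y) :
    {ω | ¬ a.Good ω}.ncard * 2 ^ k ≤
      Fintype.card (Randomness (flagProtocol (μ := μ) M κ T Δ sender)) := by
  have b1 := ncard_iUnion_mul_le (lossEvent (T := T) (Δ := Δ) (sender := sender)) h1 hT
    fun e => ncard_loss e.1 e.2.1 e.2.2.1 e.2.2.2
  have b2 := ncard_iUnion_mul_le a.transferEvent h2 hy fun ⟨⟨i, j, q, t, f, s⟩, d⟩ => by
    by_cases hc : i ∉ a.corrupt ∧ j ∉ a.corrupt ∧ i ≠ j ∧ q ≠ i ∧ q ≠ j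
    · refine le_trans (Nat.mul_le_mul_right _ (Set.ncard_le_ncard fun ω h => h.2))
        (a.ncard_transfer_fails hx hc.1 hc.2.1 hc.2.2.2.1 hc.2.2.2.2 t f s d)
    · have : a.transferEvent ((i, j, q, t, f, s), d) = ∅ :=
        Set.eq_empty_of_forall_notMem fun ω h => hc h.1
      simp [this]
  have b3 := ncard_iUnion_mul_le a.forgeryEvent h3 hκ fun ⟨⟨i, q, t, f, s, r, l⟩, d⟩ => by
    by_cases hc : q ∉ a.corrupt
    · refine le_trans (Nat.mul_le_mul_right _ (Set.ncard_le_ncard fun ω h => h.2))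
        (a.ncard_forgery hc t f s r l d)
    · have : a.forgeryEvent ((i, q, t, f, s, r, l), d) = ∅ :=
        Set.eq_empty_of_forall_notMem fun ω h => hc h.1
      simp [this]
  have hsub := (Set.ncard_le_ncard (a.not_good_subset hM)).trans ((Set.ncard_union_le _ _).trans
    (Nat.add_le_add_right (Set.ncard_union_le _ _) _))
  have h4 := Nat.mul_le_mul_right (2 ^ (k + 2)) hsub
  have e : (2 : ℕ) ^ (k + 2) = 4 * 2 ^ k := by ring
  rw [add_mul, add_mul] at h4
  have h5 := h4.trans (Nat.add_le_add (Nat.add_le_add b1 b2) b3)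
  rw [e] at h5
  have h6 : {ω | ¬ a.Good ω}.ncard * (4 * 2 ^ k) = 4 * ({ω | ¬ a.Good ω}.ncard * 2 ^ k) := by ring
  omega

end Attack

/-! ### From counting to the law of the outputs -/

theorem realizes_of_ncard_le {Δ k : ℕ} {sender : Fin n}
    (h : ∀ a : Attack (flagProtocol (μ := μ) M κ T Δ sender), {ω | ¬ a.Good ω}.ncard * 2 ^ k ≤
      Fintype.card (Randomness (flagProtocol (μ := μ) M κ T Δ sender))) :
    RealizesAuthenticatedBroadcast sender (flagProtocol (μ := μ) M κ T Δ sender)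
      ((2 : ℝ≥0∞)⁻¹ ^ k) := by
  classical
  intro corrupt m adv
  rw [outputLaw, PMF.toOuterMeasure_bind_apply]
  have hr : ∀ r, ((PMF.uniformOfFintype (Randomness (flagProtocol (μ := μ) M κ T Δ sender))).map
      (outputs _ corrupt (senderInput sender m) adv r)).toOuterMeasure
        {y | ¬ BroadcastOK corrupt sender m y} ≤ (2 : ℝ≥0∞)⁻¹ ^ k := by
    intro r
    let a : Attack (flagProtocol (μ := μ) M κ T Δ sender) :=
      ⟨corrupt, senderInput sender m, adv, r⟩
    rw [PMF.toOuterMeasure_map_apply]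
    have hsub : outputs (flagProtocol (μ := μ) M κ T Δ sender) corrupt (senderInput sender m) adv r
        ⁻¹' {y | ¬ BroadcastOK corrupt sender m y} ⊆ {ω | ¬ a.Good ω} :=
      fun ω hω hg => hω (hg.broadcastOK rfl)
    refine (MeasureTheory.measure_mono hsub).trans ?_
    rw [PMF.toOuterMeasure_uniformOfFintype_apply, ← Set.toFinset_card,
      ← Set.ncard_eq_toFinset_card']
    have h1 : ({ω | ¬ a.Good ω}.ncard : ℝ≥0∞) * 2 ^ k ≤
        (Fintype.card (Randomness (flagProtocol (μ := μ) M κ T Δ sender)) : ℝ≥0∞) := by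
      exact_mod_cast h a
    rw [← ENNReal.inv_pow]
    refine ENNReal.div_le_of_le_mul ?_
    rw [mul_comm, ← div_eq_mul_inv, ENNReal.le_div_iff_mul_le (by simp) (by simp)]
    convert h1
  calc _ ≤ ∑' r, adv.tape r * (2 : ℝ≥0∞)⁻¹ ^ k :=
        ENNReal.tsum_le_tsum fun r => mul_le_mul_right (hr r) _
    _ = _ := by rw [ENNReal.tsum_mul_right, PMF.tsum_coe, one_mul]

end AnonymousOT

/-! ### Choice of the parameters -/

open AnonymousOT in
theorem mainTheorem7 :
    ∃ d : ℕ, ∀ (n μ k : ℕ) (sender : Fin n),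
      ∃ π : AnonymousOT.AOTProtocol n (AnonymousOT.BitString μ) (AnonymousOT.Verdict n μ),
        π.rounds ≤ (n + μ + k + 2) ^ d ∧ π.len ≤ (n + μ + k + 2) ^ d ∧
          AnonymousOT.RealizesAuthenticatedBroadcast sender π ((2 : ℝ≥0∞)⁻¹ ^ k) := by
  -- The string length decides: at most `N ^ 23` positions, each repeated `N ^ 8` times.
  refine ⟨31, fun n μ k sender => ?_⟩
  obtain ⟨N, hN⟩ : ∃ N, N = n + μ + k + 2 := ⟨_, rfl⟩
  have hn : 0 < n := sender.pos
  have hN3 : 3 ≤ N := by omega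
  have hn1 : n + 1 ≤ N := by omega
  have hnN : n ≤ N := by omega
  have hμ : μ * 2 ≤ N ^ 2 := by nlinarith
  rw [← hN]
  -- With `M = (n + 1) * Δ` the tolerance `n * Δ` stays below `M`, and this `Δ` turns the Hoeffding
  -- condition `2 * M * N ^ 8 ≤ Δ ^ 2` into an equality.
  obtain ⟨Δ, hΔ⟩ : ∃ Δ, Δ = 2 * (n + 1) * N ^ 8 := ⟨_, rfl⟩
  obtain ⟨M, hM⟩ : ∃ M, M = (n + 1) * Δ := ⟨_, rfl⟩
  have hΔ0 : 0 < Δ := by rw [hΔ]; positivity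
  have hΔN : Δ ≤ N ^ 10 := by
    calc Δ ≤ N * N * N ^ 8 := by rw [hΔ]; gcongr; omega
      _ = N ^ 10 := by ring
  have hMN : M ≤ N ^ 11 := by
    calc M ≤ N * N ^ 10 := by rw [hM]; gcongr
      _ = N ^ 11 := by ring
  have hR : M + n ≤ N ^ 12 := by
    have : N ≤ N ^ 11 := Nat.le_self_pow (by norm_num) N
    calc M + n ≤ N ^ 11 + N ^ 11 := by omega
      _ ≤ N * N ^ 11 := by nlinarith
      _ = N ^ 12 := by ring
  have hpos : Fintype.card (Position n μ M (N ^ 8)) ≤ N ^ 23 := by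
    calc Fintype.card (Position n μ M (N ^ 8)) = μ * 2 * (n * (M * (n * N ^ 8))) := by simp
      _ ≤ N ^ 2 * (N * (N ^ 11 * (N * N ^ 8))) := by gcongr
      _ = N ^ 23 := by ring
  have hdec : Fintype.card (Attack.Decisions n μ) ≤ 2 ^ N ^ 6 := by
    calc Fintype.card (Attack.Decisions n μ) = 2 ^ (n * (n * (μ * 2 * (n * n)))) := by simp
      _ ≤ 2 ^ (N * (N * (N ^ 2 * (N * N)))) := by gcongr; norm_num
      _ = 2 ^ N ^ 6 := by ring
  have hpow : ∀ e, e ≤ 37 → N ^ e ≤ 2 ^ (37 * N) := by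
    intro e he
    calc N ^ e ≤ N ^ 37 := Nat.pow_le_pow_right (by omega) he
      _ ≤ (2 ^ N) ^ 37 := Nat.pow_le_pow_left Nat.lt_two_pow_self.le 37
      _ = 2 ^ (37 * N) := by rw [← pow_mul, mul_comm]
  -- The exponent of the union bounds: `37 * N` covers the indices of the events, of which there are
  -- at most `N ^ 37`, and `N ^ 6` covers the tables of decisions.
  have hsum : 37 * N + N ^ 6 + (k + 2) ≤ N ^ 8 := by
    have h1 : 3 ^ 5 * N ≤ N ^ 6 := by
      calc 3 ^ 5 * N ≤ N ^ 5 * N := by gcongr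
        _ = N ^ 6 := by ring
    have h2 : 3 ^ 2 * N ^ 6 ≤ N ^ 8 := by
      calc 3 ^ 2 * N ^ 6 ≤ N ^ 2 * N ^ 6 := by gcongr
        _ = N ^ 8 := by ring
    omega
  refine ⟨flagProtocol M (N ^ 8) (N ^ 8) Δ sender, ?_, ?_, ?_⟩
  · exact hR.trans (Nat.pow_le_pow_right (by omega) (by norm_num))
  · calc wireLen n μ M (N ^ 8) (N ^ 8)
        = Fintype.card (Position n μ M (N ^ 8)) * N ^ 8 := by
          rw [wireLen, Fintype.card_prod, Fintype.card_fin]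
      _ ≤ N ^ 23 * N ^ 8 := by gcongr
      _ = N ^ 31 := by ring
  · refine realizes_of_ncard_le fun a => a.ncard_not_good (x := N ^ 8) (y := 37 * N + N ^ 6)
      ?_ ?_ hsum hsum hsum ?_ ?_ ?_
    · rw [hM]; nlinarith
    · refine le_of_eq ?_
      calc 2 * M * N ^ 8 = 2 * (n + 1) * N ^ 8 * Δ := by rw [hM]; ring
        _ = Δ ^ 2 := by rw [← hΔ]; ring
    · rw [Fintype.card_prod, Fintype.card_prod, Fintype.card_prod, Fintype.card_fin,
        Fintype.card_fin]
      calc (M + n) * (n * (n * Fintype.card (Position n μ M (N ^ 8))))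
          ≤ N ^ 12 * (N * (N * N ^ 23)) := by gcongr
        _ = N ^ 37 := by ring
        _ ≤ 2 ^ (37 * N) := hpow _ le_rfl
        _ ≤ _ := Nat.pow_le_pow_right (by norm_num) (by omega)
    · rw [Fintype.card_prod, pow_add]
      refine Nat.mul_le_mul ?_ hdec
      calc _ = n * (n * (n * (n * (μ * 2 * n)))) := by simp
        _ ≤ N * (N * (N * (N * (N ^ 2 * N)))) := by gcongr
        _ = N ^ 7 := by ring
        _ ≤ _ := hpow _ (by norm_num)
    · rw [Fintype.card_prod, pow_add]
      refine Nat.mul_le_mul ?_ hdec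
      calc _ = n * (n * (n * (μ * 2 * (n * (M * n))))) := by simp
        _ ≤ N * (N * (N * (N ^ 2 * (N * (N ^ 11 * N))))) := by gcongr
        _ = N ^ 18 := by ring
        _ ≤ _ := hpow _ (by norm_num)
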